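/- Let $G$ be a finite group and let $\mathrm{Irr}(G)$ be the set of its irreducible complex characters. A character $\chi\in\mathrm{Irr}(G)$ is called irrational if the field $\mathbb{Q}(\chi)=\mathbb{Q}(\chi(g) : g\in G)$ is different from $\mathbb{Q}$. An element $x\in G$ is called irrational if the field $\mathbb{Q}(x)=\mathbb{Q}(\psi(x) : \psi\in\mathrm{Irr}(G))$ is different from $\mathbb{Q}$; this depends only on the conjugacy class of $x$, and a conjugacy class is called irrational if its elements are irrational. Theorem. Let $G$ be a finite group and let $n\ge 0$ be an integer. (a) If $G$ has exactly $n$ irrational conjugacy classes, then $G$ has at most $\frac{n^2}{2}$ irrational irreducible characters. (b) If $G$ has exactly $n$ irrational irreducible characters, then $G$ has at most $\frac{n^2}{2}$ irrational conjugacy classes. -/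

import Mathlib

/-- The set of irreducible complex characters of `G`: the functions on `G` that are the character
of an irreducible complex representation of finite degree. -/
def IrrChar (G : Type*) [Group G] : Set (G → ℂ) :=
  {χ | ∃ (d : ℕ) (ρ : Representation ℂ G (Fin d → ℂ)), ρ.IsIrreducible ∧ χ = ρ.character}

/-- The field of values of a complex-valued function on `G`: the extension of `ℚ` generated by
the numbers `χ g`, with `g` in `G`. -/
noncomputable def charField {G : Type*} (χ : G → ℂ) : IntermediateField ℚ ℂ :=
  IntermediateField.adjoin ℚ {z | ∃ g : G, χ g = z}

/-- The field of values of an element `x` of `G`: the extension of `ℚ` generated by the numbers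
`ψ x`, with `ψ` an irreducible complex character of `G`. -/
noncomputable def elementField {G : Type*} [Group G] (x : G) : IntermediateField ℚ ℂ :=
  IntermediateField.adjoin ℚ {z | ∃ ψ ∈ IrrChar G, ψ x = z}

/-- The irreducible complex characters whose field of values is not `ℚ`. -/
def irrationalChars (G : Type*) [Group G] : Set (G → ℂ) :=
  {χ | χ ∈ IrrChar G ∧ charField χ ≠ ⊥}

/-- The conjugacy classes of the elements whose field of values is not `ℚ`. -/
def irrationalClasses (G : Type*) [Group G] : Set (ConjClasses G) :=
  {K | ∃ x : G, ConjClasses.mk x = K ∧ elementField x ≠ ⊥}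

/-! The group `ℂ ≃+* ℂ` acts on irreducible characters through their values, and on conjugacy
classes through powers: `τ` raises the `|G|`-th roots of unity to a power `k`, and `τ (χ g) = χ (g ^
k)`. Rational characters and classes are exactly the fixed points. The character table is an
invertible matrix matching the two actions, so it carries invariant functions to invariant functions
(Brauer's permutation lemma). Hence both sets have the same size and the same number of orbits,
hence the same excess `e` of points over orbits. If `a` points move on one side and `b > 0` on the
other, then `a ≤ 2e` and `e ≤ b - 1`, so `a ≤ 2b - 2 ≤ b² / 2`. If `b = 0`, then `e = 0` and `a =
0`. -/

/-! ### Automorphisms of `ℂ` and rationality -/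

theorem IsConjRoot.exists_ringEquiv_complex {z w : ℂ} (hz : IsAlgebraic ℚ z)
    (h : IsConjRoot ℚ z w) : ∃ τ : ℂ ≃+* ℂ, τ z = w := by
  let A := algebraicClosure ℚ ℂ
  have hw : IsAlgebraic ℚ w := by
    rw [isAlgebraic_iff_isIntegral] at hz ⊢
    exact (h.isIntegral_iff).1 hz
  let z' : A := ⟨z, mem_algebraicClosure_iff.2 hz⟩
  let w' : A := ⟨w, mem_algebraicClosure_iff.2 hw⟩
  have h' : IsConjRoot ℚ z' w' :=
    (isConjRoot_algHom_iff (algebraicClosure ℚ ℂ).val).1 h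
  have : IsAlgClosure ℚ A := algebraicClosure.isAlgClosure ℚ ℂ
  have : Normal ℚ A := IsAlgClosure.normal ℚ A
  obtain ⟨σ, hσ⟩ := (h'.symm).exists_algEquiv
  -- To extend `σ` to `ℂ`, apply it to the coefficients of polynomials in a transcendence basis,
  -- then lift to the algebraic closure.
  obtain ⟨s, hs⟩ := exists_isTranscendenceBasis A ℂ
  let S := Algebra.adjoin A (Set.range ((↑) : s → ℂ))
  have : IsAlgClosure S ℂ := IsAlgClosed.isAlgClosure_of_transcendence_basis _ hs
  let e : S ≃+* S := hs.1.aevalEquiv.symm.toRingEquiv.trans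
    ((MvPolynomial.mapEquiv s σ.toRingEquiv).trans hs.1.aevalEquiv.toRingEquiv)
  have he (a : A) : e (algebraMap A S a) = algebraMap A S (σ a) := by
    simp only [e, RingEquiv.trans_apply, AlgEquiv.coe_ringEquiv,
      AlgEquiv.commutes, MvPolynomial.algebraMap_eq, MvPolynomial.mapEquiv_apply]
    rw [MvPolynomial.map_C, ← MvPolynomial.algebraMap_eq, AlgEquiv.commutes]
    rfl
  refine ⟨IsAlgClosure.equivOfEquiv ℂ ℂ e, ?_⟩
  have := IsAlgClosure.equivOfEquiv_algebraMap ℂ ℂ e (algebraMap A S z')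
  rw [he, hσ] at this
  exact this

theorem Complex.mem_bot_iff_forall_ringEquiv {z : ℂ} (hz : IsAlgebraic ℚ z) :
    z ∈ (⊥ : IntermediateField ℚ ℂ) ↔ ∀ τ : ℂ ≃+* ℂ, τ z = z := by
  constructor
  · rintro ⟨q, rfl⟩ τ
    simp
  · intro h
    rw [IntermediateField.mem_bot, ← Algebra.mem_bot]
    by_contra hmem
    obtain ⟨w, hne, hw⟩ := (notMem_iff_exists_ne_and_isConjRoot
      (minpoly.irreducible hz.isIntegral).separable (IsAlgClosed.splits _)).1 hmem
    obtain ⟨τ, hτ⟩ := hw.exists_ringEquiv_complex hz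
    exact hne (hτ ▸ (h τ).symm)

-- `X ^ N - 1` is separable, so `f` is diagonalizable. One choice of eigenvalues and multiplicities
-- serves all `k`, which later turns Galois conjugation into a power map.
open Module Module.End Polynomial in
theorem Module.End.exists_trace_pow_eq_sum {K V : Type*} [Field K] [IsAlgClosed K] [AddCommGroup V]
    [Module K V] [FiniteDimensional K V] {N : ℕ} [NeZero (N : K)] {f : End K V} (hf : f ^ N = 1) :
    ∃ (s : Finset K) (m : K → ℕ), (∀ μ ∈ s, μ ^ N = 1) ∧
      ∀ k, LinearMap.trace K V (f ^ k) = ∑ μ ∈ s, m μ * μ ^ k := by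
  classical
  have hsq : Squarefree (X ^ N - 1 : K[X]) :=
    (separable_X_pow_sub_C (1 : K) (NeZero.ne _) one_ne_zero).squarefree
  have hss : f.IsSemisimple :=
    isSemisimple_of_squarefree_aeval_eq_zero hsq (by simp [hf])
  have hint : DirectSum.IsInternal f.eigenspace :=
    DirectSum.isInternal_submodule_of_iSupIndep_of_iSup_eq_top f.eigenspaces_iSupIndep
      (hss.iSup_eigenspace_eq_top)
  have hfin : {μ | f.eigenspace μ ≠ ⊥}.Finite :=
    WellFoundedGT.finite_ne_bot_of_iSupIndep f.eigenspaces_iSupIndep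
  have hpow (k : ℕ) (μ : K) {v : V} (hv : v ∈ f.eigenspace μ) : (f ^ k) v = μ ^ k • v := by
    induction k with
    | zero => simp
    | succ k ih =>
      rw [pow_succ', Module.End.mul_apply, ih, map_smul, mem_eigenspace_iff.1 hv, smul_smul, pow_succ]
  refine ⟨hfin.toFinset, fun μ ↦ finrank K (f.eigenspace μ), ?_, ?_⟩
  · intro μ hμ
    obtain ⟨v, hv, hv0⟩ := Submodule.exists_mem_ne_zero_of_ne_bot (hfin.mem_toFinset.1 hμ)
    have := hpow N μ hv
    rw [hf, Module.End.one_apply] at this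
    have h2 : (μ ^ N - 1) • v = 0 := by rw [sub_smul, ← this, one_smul, sub_self]
    exact sub_eq_zero.1 ((smul_eq_zero.1 h2).resolve_right hv0)
  · intro k
    have hmaps : ∀ μ, Set.MapsTo (f ^ k) (f.eigenspace μ) (f.eigenspace μ) := fun μ v hv ↦ by
      rw [hpow k μ hv]; exact Submodule.smul_mem _ _ hv
    rw [LinearMap.trace_eq_sum_trace_restrict' hint hfin hmaps]
    refine Finset.sum_congr rfl fun μ _ ↦ ?_
    have : (f ^ k).restrict (hmaps μ) = μ ^ k • LinearMap.id := by
      ext v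
      exact hpow k μ v.2
    rw [this, map_smul, LinearMap.trace_id, smul_eq_mul, mul_comm]

/-! ### Counting orbits and moved points -/

open Classical in
/-- For a surjection `π` of finite types, the points that share their fibre with another point
number at most twice the excess `|X| - |Q|`, at least this excess, and more than it if there is such a point. -/
theorem Function.Surjective.card_nontrivial_fibers {X Q : Type*} [Finite X] [Finite Q] {π : X → Q}
    (hπ : Function.Surjective π) :
    {x | ∃ y, y ≠ x ∧ π y = π x}.ncard + 2 * Nat.card Q ≤ 2 * Nat.card X ∧
      Nat.card X ≤ {x | ∃ y, y ≠ x ∧ π y = π x}.ncard + Nat.card Q ∧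
      ({x | ∃ y, y ≠ x ∧ π y = π x}.ncard ≠ 0 →
        Nat.card X + 1 ≤ {x | ∃ y, y ≠ x ∧ π y = π x}.ncard + Nat.card Q) := by
  cases nonempty_fintype X
  cases nonempty_fintype Q
  set M : Finset X := {x | ∃ y, y ≠ x ∧ π y = π x} with hM
  have hMc : {x | ∃ y, y ≠ x ∧ π y = π x}.ncard = M.card := by
    rw [Set.ncard_eq_toFinset_card']; congr 1; ext; simp [hM]
  have h1 : Fintype.card X = ∑ q, (Finset.univ.filter (π · = q)).card :=
    Finset.card_eq_sum_card_fiberwise (fun _ _ ↦ Finset.mem_univ _)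
  have h2 : M.card = ∑ q, (M.filter (π · = q)).card :=
    Finset.card_eq_sum_card_fiberwise (fun _ _ ↦ Finset.mem_univ _)
  have h3 : Fintype.card Q = ∑ _q : Q, 1 := by simp
  -- A fibre is either a single point outside `M`, or lies in `M` and has at least two points; all
  -- three bounds follow by summing over fibres.
  have key (q : Q) : ((Finset.univ.filter (π · = q)).card = 1 ∧ (M.filter (π · = q)).card = 0) ∨
      ((M.filter (π · = q)).card = (Finset.univ.filter (π · = q)).card ∧
        2 ≤ (Finset.univ.filter (π · = q)).card) := by
    obtain ⟨x, rfl⟩ := hπ q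
    by_cases hx : x ∈ M
    · right
      obtain ⟨y, hy, hyx⟩ := (Finset.mem_filter.1 hx).2
      constructor
      · congr 1
        ext z
        simp only [hM, Finset.mem_filter, Finset.mem_univ, true_and, and_iff_right_iff_imp]
        intro hz
        by_cases hzx : z = x
        · exact ⟨y, hzx ▸ hy, hyx.trans hz.symm⟩
        · exact ⟨x, Ne.symm hzx, hz.symm⟩
      · exact Finset.one_lt_card.2 ⟨y, by simp [hyx], x, by simp, hy⟩
    · left
      have hx' : ∀ y, π y = π x → y = x := by
        intro y hy
        by_contra hne
        exact hx (by simpa [hM] using ⟨y, hne, hy⟩)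
      constructor
      · rw [Finset.card_eq_one]
        exact ⟨x, by ext y; simpa using ⟨hx' y, fun h ↦ h ▸ rfl⟩⟩
      · rw [Finset.card_eq_zero, Finset.filter_eq_empty_iff]
        intro y hy hyx
        exact hx (hx' y hyx ▸ hy)
  rw [hMc, Nat.card_eq_fintype_card, Nat.card_eq_fintype_card]
  refine ⟨?_, ?_, ?_⟩
  · rw [h1, h2, h3, Finset.mul_sum, Finset.mul_sum, ← Finset.sum_add_distrib]
    refine Finset.sum_le_sum fun q _ ↦ ?_
    rcases key q with h | h <;> omega
  · rw [h1, h2, h3, ← Finset.sum_add_distrib]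
    refine Finset.sum_le_sum fun q _ ↦ ?_
    rcases key q with h | h <;> omega
  · intro hne
    obtain ⟨x, hx⟩ := Finset.card_ne_zero.1 hne
    rw [h1, h2, h3, ← Finset.sum_add_distrib, Nat.add_one_le_iff]
    refine Finset.sum_lt_sum (fun q _ ↦ ?_) ⟨π x, Finset.mem_univ _, ?_⟩
    · rcases key q with h | h <;> omega
    · have : (M.filter (π · = π x)).card ≠ 0 :=
        Finset.card_ne_zero.2 ⟨x, Finset.mem_filter.2 ⟨hx, rfl⟩⟩
      rcases key (π x) with h | h <;> omega

open MulAction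

/-- The functions on a `Γ`-set that are constant on orbits. -/
def invariantFunctions (R Γ X : Type*) [Semiring R] [Group Γ] [MulAction Γ X] :
    Submodule R (X → R) where
  carrier := {c | ∀ (γ : Γ) x, c (γ • x) = c x}
  add_mem' ha hb γ x := by simp [ha γ x, hb γ x]
  zero_mem' γ x := rfl
  smul_mem' r c hc γ x := by simp [hc γ x]

theorem finrank_invariantFunctions (R Γ X : Type*) [Field R] [Group Γ] [MulAction Γ X] [Finite X] :
    Module.finrank R (invariantFunctions R Γ X) = Nat.card (orbitRel.Quotient Γ X) := by
  let e : (orbitRel.Quotient Γ X → R) ≃ₗ[R] invariantFunctions R Γ X :=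
    { toFun c := ⟨fun x ↦ c (Quotient.mk'' x), fun γ x ↦ by
        exact congrArg c (Quotient.sound' (orbitRel_apply.2 (mem_orbit x γ)))⟩
      map_add' _ _ := rfl
      map_smul' _ _ := rfl
      invFun c := Quotient.lift c.1 (by
        rintro a b ⟨γ, rfl⟩
        exact c.2 γ b)
      left_inv c := by
        funext q
        induction q using Quotient.inductionOn'
        rfl
      right_inv c := rfl }
  cases nonempty_fintype (orbitRel.Quotient Γ X)
  rw [← e.finrank_eq, Module.finrank_fintype_fun_eq_card, Nat.card_eq_fintype_card]

theorem setOf_moved_eq (Γ Z : Type*) [Group Γ] [MulAction Γ Z] : {x : Z | ∃ γ : Γ, γ • x ≠ x} =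
    {x | ∃ y, y ≠ x ∧ (Quotient.mk'' y : orbitRel.Quotient Γ Z) = Quotient.mk'' x} := by
  ext x
  simp only [Set.mem_ofPred_eq, Quotient.eq'', orbitRel_apply]
  constructor
  · rintro ⟨γ, h⟩
    exact ⟨γ • x, h, mem_orbit x γ⟩
  · rintro ⟨_, h, γ, rfl⟩
    exact ⟨γ, h⟩

theorem ncard_moved_le {R Γ X Y : Type*} [Field R] [Group Γ] [MulAction Γ X] [MulAction Γ Y]
    [Finite X] [Finite Y] (L : (X → R) ≃ₗ[R] (Y → R))
    (hL : ∀ c, c ∈ invariantFunctions R Γ X ↔ L c ∈ invariantFunctions R Γ Y) :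
    2 * {x : X | ∃ γ : Γ, γ • x ≠ x}.ncard ≤ {y : Y | ∃ γ : Γ, γ • y ≠ y}.ncard ^ 2 := by
  have hcard : Nat.card X = Nat.card Y := by
    cases nonempty_fintype X
    cases nonempty_fintype Y
    simpa using L.finrank_eq
  have horb : Nat.card (orbitRel.Quotient Γ X) = Nat.card (orbitRel.Quotient Γ Y) := by
    rw [← finrank_invariantFunctions R, ← finrank_invariantFunctions R]
    have : (invariantFunctions R Γ X).map (L : (X → R) →ₗ[R] (Y → R)) =
        invariantFunctions R Γ Y := by
      ext d
      rw [Submodule.mem_map_equiv, hL, LinearEquiv.apply_symm_apply]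
    rw [← this]
    exact (L.submoduleMap _).finrank_eq
  have hX := (Quotient.mk''_surjective (s₁ := orbitRel Γ X)).card_nontrivial_fibers
  have hY := (Quotient.mk''_surjective (s₁ := orbitRel Γ Y)).card_nontrivial_fibers
  have eX := setOf_moved_eq Γ X
  have eY := setOf_moved_eq Γ Y
  unfold orbitRel.Quotient at *
  rw [← eX] at hX
  rw [← eY] at hY
  set a := {x : X | ∃ γ : Γ, γ • x ≠ x}.ncard
  set b := {y : Y | ∃ γ : Γ, γ • y ≠ y}.ncard
  rcases Nat.eq_zero_or_pos b with hb | hb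
  · have ha : a = 0 := by omega
    simp [ha]
  · obtain ⟨h1, -⟩ := hX
    have h2 := hY.2.2 hb.ne'
    have h3 : a + 2 ≤ 2 * b := by omega
    zify at h3 ⊢
    -- `4b - 4 ≤ b²` is `(b - 2)² ≥ 0`.
    nlinarith [sq_nonneg ((b : ℤ) - 2)]

/-! ### Galois conjugates of representations -/

namespace Representation

theorem isIrreducible_iff {k G V : Type*} [Field k] [Monoid G] [AddCommGroup V] [Module k V]
    (ρ : Representation k G V) : ρ.IsIrreducible ↔ Nontrivial V ∧
      ∀ W : Submodule k V, (∀ g, ∀ v ∈ W, ρ g v ∈ W) → W = ⊥ ∨ W = ⊤ := by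
  constructor
  · intro h
    refine ⟨?_, fun W hW ↦ ?_⟩
    · by_contra hV
      rw [not_nontrivial_iff_subsingleton] at hV
      exact bot_ne_top (α := Subrepresentation ρ)
        (Subrepresentation.toSubmodule_injective (Subsingleton.elim _ _))
    · exact (h.eq_bot_or_eq_top ⟨W, fun g v hv ↦ hW g v hv⟩).imp
        (congrArg Subrepresentation.toSubmodule) (congrArg Subrepresentation.toSubmodule)
  · rintro ⟨hV, h⟩
    exact
      { exists_pair_ne := ⟨⊥, ⊤, fun h' ↦ bot_ne_top (α := Submodule k V)
          (congrArg Subrepresentation.toSubmodule h')⟩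
        eq_bot_or_eq_top := fun σ ↦ (h σ.toSubmodule fun g v hv ↦
          σ.apply_mem_toSubmodule g hv).imp
            (fun h ↦ Subrepresentation.toSubmodule_injective h)
            (fun h ↦ Subrepresentation.toSubmodule_injective h) }

/-- The representation obtained by applying a field automorphism to the matrix entries. -/
def galoisConj {k G n : Type*} [Field k] [Monoid G] (τ : k ≃+* k)
    (ρ : Representation k G (n → k)) : Representation k G (n → k) where
  toFun g :=
    { toFun v := τ ∘ ρ g (τ.symm ∘ v)
      map_add' v w := by
        have : τ.symm ∘ (v + w) = τ.symm ∘ v + τ.symm ∘ w := by ext; simp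
        rw [this, map_add]; ext; simp
      map_smul' c v := by
        have : τ.symm ∘ (c • v) = τ.symm c • (τ.symm ∘ v) := by ext; simp
        rw [this, map_smul]; ext; simp }
  map_one' := by ext; simp
  map_mul' g h := by
    ext v i
    simp [Function.comp_def]

theorem galoisConj_apply {k G n : Type*} [Field k] [Monoid G] (τ : k ≃+* k)
    (ρ : Representation k G (n → k)) (g : G) (v : n → k) :
    ρ.galoisConj τ g v = τ ∘ ρ g (τ.symm ∘ v) := rfl

theorem character_galoisConj {k G n : Type*} [Field k] [Monoid G] [Finite n] (τ : k ≃+* k)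
    (ρ : Representation k G (n → k)) (g : G) :
    (ρ.galoisConj τ).character g = τ (ρ.character g) := by
  classical
  cases nonempty_fintype n
  simp only [character, LinearMap.trace_eq_matrix_trace k (Pi.basisFun k n), Matrix.trace,
    Matrix.diag_apply, map_sum, LinearMap.toMatrix_apply, Pi.basisFun_apply, Pi.basisFun_repr,
    galoisConj_apply, Function.comp_apply]
  refine Finset.sum_congr rfl fun i _ ↦ ?_
  have : τ.symm ∘ (Pi.single i 1 : n → k) = Pi.single i 1 := by
    ext j
    simp [Pi.single_apply, apply_ite τ.symm]
  rw [this]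

theorem IsIrreducible.galoisConj {k G n : Type*} [Field k] [Monoid G] (τ : k ≃+* k)
    {ρ : Representation k G (n → k)} (h : ρ.IsIrreducible) : (ρ.galoisConj τ).IsIrreducible := by
  rw [isIrreducible_iff] at h ⊢
  refine ⟨h.1, fun W hW ↦ ?_⟩
  -- Entrywise `τ` is a semilinear bijection, so pulling back along it turns subspaces stable under
  -- the conjugate into subspaces stable under `ρ`.
  let W' : Submodule k (n → k) :=
    { carrier := {v | τ ∘ v ∈ W}
      zero_mem' := by
        have : τ ∘ (0 : n → k) = 0 := by ext; simp
        simp [this]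
      add_mem' {v w} hv hw := by
        have : τ ∘ (v + w) = τ ∘ v + τ ∘ w := by ext; simp
        simpa [this] using W.add_mem hv hw
      smul_mem' c v hv := by
        have : τ ∘ (c • v) = τ c • (τ ∘ v) := by ext; simp
        simpa [this] using W.smul_mem (τ c) hv }
  have hmem (v : n → k) : v ∈ W ↔ τ.symm ∘ v ∈ W' := by
    change _ ↔ τ ∘ τ.symm ∘ v ∈ W
    rw [← Function.comp_assoc, show τ ∘ τ.symm = id from funext τ.apply_symm_apply,
      Function.id_comp]
  have hW' : ∀ g, ∀ v ∈ W', ρ g v ∈ W' := by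
    intro g v hv
    have := hW g _ hv
    rwa [galoisConj_apply, ← Function.comp_assoc τ.symm,
      show τ.symm ∘ τ = id from funext τ.symm_apply_apply, Function.id_comp] at this
  refine (h.2 W' hW').imp (fun h0 ↦ ?_) (fun h1 ↦ ?_)
  · rw [Submodule.eq_bot_iff]
    intro v hv
    rw [hmem, h0, Submodule.mem_bot] at hv
    ext i
    simpa using congrFun hv i
  · rw [Submodule.eq_top_iff']
    intro v
    rw [hmem, h1]
    trivial

end Representation

/-! ### Orthogonality and completeness of irreducible characters -/

section IrrChar

variable {G : Type*} [Group G]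

theorem IrrChar.comp_mem {χ : G → ℂ} (hχ : χ ∈ IrrChar G) (τ : ℂ ≃+* ℂ) :
    (fun g ↦ τ (χ g)) ∈ IrrChar G := by
  obtain ⟨d, ρ, hρ, rfl⟩ := hχ
  exact ⟨d, ρ.galoisConj τ, hρ.galoisConj τ, by ext g; rw [ρ.character_galoisConj]⟩

theorem IrrChar.map_mul_comm {χ : G → ℂ} (hχ : χ ∈ IrrChar G) (g h : G) :
    χ (g * h) = χ (h * g) := by
  obtain ⟨d, ρ, hρ, rfl⟩ := hχ
  exact ρ.char_mul_comm h g

theorem IrrChar.eq_of_isConj {χ : G → ℂ} (hχ : χ ∈ IrrChar G) {g h : G} (hgh : IsConj g h) :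
    χ g = χ h := by
  obtain ⟨c, rfl⟩ := isConj_iff.1 hgh
  rw [map_mul_comm hχ, inv_mul_cancel_left]

theorem IrrChar.orthogonality [Fintype G] {χ ψ : G → ℂ} (hχ : χ ∈ IrrChar G)
    (hψ : ψ ∈ IrrChar G) : ∑ g, χ g * ψ g⁻¹ = 0 ↔ χ ≠ ψ := by
  obtain ⟨d, ρ, hρ, rfl⟩ := hχ
  obtain ⟨e, σ, hσ, rfl⟩ := hψ
  have hG : (Nat.card G : ℂ) ≠ 0 := Nat.cast_ne_zero.2 Nat.card_pos.ne'
  let : Invertible (Nat.card G : ℂ) := invertibleOfNonzero hG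
  classical
  by_cases h : ρ.character = σ.character
  · rw [h]
    have := Representation.char_orthonormal σ σ
    rw [if_pos ⟨Representation.Equiv.refl σ⟩] at this
    refine iff_of_false (fun h0 ↦ ?_) (by simp)
    simp [h0] at this
  · refine iff_of_true ?_ h
    have := Representation.char_orthonormal ρ σ
    rw [if_neg (fun ⟨φ⟩ ↦ h (Representation.char_iso φ).symm)] at this
    exact (mul_eq_zero.1 this).resolve_left (inv_ne_zero hG)

theorem IrrChar.linearIndependent [Finite G] :
    LinearIndependent ℂ (fun χ : IrrChar G ↦ (χ : G → ℂ)) := by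
  classical
  cases nonempty_fintype G
  rw [linearIndependent_iff']
  intro s c hc χ hχ
  have h1 : ∑ g, (∑ ψ ∈ s, c ψ • (ψ : G → ℂ)) g * χ.1 g⁻¹ = 0 := by rw [hc]; simp
  simp only [Finset.sum_apply, Pi.smul_apply, smul_eq_mul, Finset.sum_mul, mul_assoc] at h1
  rw [Finset.sum_comm] at h1
  simp only [← Finset.mul_sum] at h1
  rw [Finset.sum_eq_single χ (fun ψ _ hne ↦ by
      rw [(IrrChar.orthogonality ψ.2 χ.2).2 (fun h ↦ hne (Subtype.ext h)), mul_zero])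
    (fun h ↦ absurd hχ h)] at h1
  exact (mul_eq_zero.1 h1).resolve_right (fun h ↦ (IrrChar.orthogonality χ.2 χ.2).1 h rfl)

instance IrrChar.finite [Finite G] : Finite (IrrChar G) :=
  IrrChar.linearIndependent.finite

-- The element `∑ f(g) g` of the group algebra is central, so each of its Wedderburn components is
-- scalar. Each matrix block is an irreducible representation, so the hypothesis makes the
-- component's trace, hence the scalar, vanish.
open MonoidAlgebra in
theorem IrrChar.eq_zero_of_forall_sum_eq_zero [Fintype G] {f : G → ℂ}
    (hf : ∀ g h, f (g * h) = f (h * g))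
    (h : ∀ χ ∈ IrrChar G, ∑ g, f g * χ g = 0) : f = 0 := by
  classical
  have : NeZero (Nat.card G : ℂ) := ⟨Nat.cast_ne_zero.2 Nat.card_pos.ne'⟩
  obtain ⟨n, d, hd, ⟨e⟩⟩ :=
    IsSemisimpleRing.exists_algEquiv_pi_matrix_of_isAlgClosed ℂ (MonoidAlgebra ℂ G)
  let a : MonoidAlgebra ℂ G := ∑ g, single g (f g)
  have ha : ∀ x, x * a = a * x := by
    intro x
    induction x using MonoidAlgebra.induction_linear with
    | zero => simp
    | add x y hx hy => rw [add_mul, mul_add, hx, hy]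
    | single g c =>
      simp only [a, Finset.mul_sum, Finset.sum_mul, single_mul_single]
      refine Fintype.sum_equiv (MulAut.conj g).toEquiv _ _ fun x ↦ ?_
      have : f (g * x * g⁻¹) = f x := by rw [hf, inv_mul_cancel_left]
      simp [this, mul_comm]
  have hcomp (i : Fin n) : e a i = 0 := by
    let ρ : Representation ℂ G (Fin (d i) → ℂ) :=
      ((Matrix.toLinAlgEquiv' : Matrix (Fin (d i)) (Fin (d i)) ℂ ≃ₐ[ℂ] _).toAlgHom.comp
        ((Pi.evalAlgHom ℂ _ i).comp e.toAlgHom)).toMonoidHom.comp (of ℂ G)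
    have hρ_apply (g : G) : ρ g = Matrix.toLin' (e (single g 1) i) := rfl
    have hspan (W : Submodule ℂ (Fin (d i) → ℂ)) (hW : ∀ g, ∀ v ∈ W, ρ g v ∈ W)
        (M : Matrix (Fin (d i)) (Fin (d i)) ℂ) (v) (hv : v ∈ W) : M.mulVec v ∈ W := by
      obtain ⟨x, hx⟩ := e.surjective (Pi.single i M)
      have hM : M = e x i := by rw [hx, Pi.single_eq_same]
      rw [hM]
      clear hx hM
      induction x using MonoidAlgebra.induction_linear with
      | zero => simp
      | add x y hx hy =>
        rw [map_add, Pi.add_apply, Matrix.add_mulVec]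
        exact W.add_mem hx hy
      | single g c =>
        have h1 : single g c = c • (single g 1 : MonoidAlgebra ℂ G) := by simp
        rw [h1, map_smul, Pi.smul_apply, Matrix.smul_mulVec]
        exact W.smul_mem c (hW g v hv)
    have hirr : ρ.IsIrreducible := by
      rw [Representation.isIrreducible_iff]
      refine ⟨inferInstance, fun W hW ↦ or_iff_not_imp_left.2 fun h0 ↦ ?_⟩
      obtain ⟨v, hv, hv0⟩ := Submodule.exists_mem_ne_zero_of_ne_bot h0
      obtain ⟨j, hj⟩ := Function.ne_iff.1 hv0
      rw [Submodule.eq_top_iff']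
      intro w
      -- This rank-one matrix sends `v` to `w`.
      have := hspan W hW (Matrix.vecMulVec w (Pi.single j (v j)⁻¹)) v hv
      rw [Matrix.vecMulVec_mulVec] at this
      simpa [inv_mul_cancel₀ hj] using this
    have hcomm (M : Matrix (Fin (d i)) (Fin (d i)) ℂ) : Commute M (e a i) := by
      obtain ⟨x, hx⟩ := e.surjective (Pi.single i M)
      have hM : M = e x i := by rw [hx, Pi.single_eq_same]
      rw [hM, Commute, SemiconjBy, ← Pi.mul_apply, ← Pi.mul_apply, ← map_mul, ← map_mul, ha]
    obtain ⟨c, hc⟩ := Matrix.mem_range_scalar_of_commute_single (M := e a i)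
      (fun _ _ _ ↦ hcomm _)
    have htr : (e a i).trace = 0 := by
      rw [← h ρ.character ⟨d i, ρ, hirr, rfl⟩]
      simp only [a, map_sum, Finset.sum_apply, Matrix.trace_sum]
      refine Finset.sum_congr rfl fun g _ ↦ ?_
      have h1 : single g (f g) = f g • (single g 1 : MonoidAlgebra ℂ G) := by simp
      rw [h1, map_smul, Pi.smul_apply, Matrix.trace_smul, Representation.character, hρ_apply,
        Matrix.trace_toLin'_eq, smul_eq_mul]
    rw [← hc] at htr ⊢
    have : (d i : ℂ) ≠ 0 := Nat.cast_ne_zero.2 (NeZero.ne _)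
    have hc0 : c = 0 := by simpa [this] using htr
    simp [hc0]
  have ha0 : a = 0 := e.injective (by ext1 i; rw [hcomp, map_zero, Pi.zero_apply])
  funext g
  have := congrArg (fun x : MonoidAlgebra ℂ G ↦ x.coeff g) ha0
  simpa [a, Finsupp.single_apply] using this

end IrrChar

/-! ### The two Galois actions and the character table -/

section GaloisAction

variable {G : Type*} [Group G]

/-- An exponent `k` such that the automorphism `τ` maps each `N`-th root of unity `ζ` to `ζ ^ k`. -/
noncomputable def cyclotomicExponent (N : ℕ) [NeZero N] (τ : ℂ ≃+* ℂ) : ℕ :=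
  (modularCyclotomicCharacter.toFun N τ).val

theorem map_eq_pow_cyclotomicExponent {N : ℕ} [NeZero N] (τ : ℂ ≃+* ℂ) {ζ : ℂ} (hζ : ζ ^ N = 1) :
    τ ζ = ζ ^ cyclotomicExponent N τ :=
  modularCyclotomicCharacter.toFun_spec' τ (rootsOfUnity.mkOfPowEq ζ hζ).2

theorem IrrChar.exists_eq_sum [Finite G] {χ : G → ℂ} (hχ : χ ∈ IrrChar G) (g : G) :
    ∃ (s : Finset ℂ) (m : ℂ → ℕ), (∀ μ ∈ s, μ ^ Nat.card G = 1) ∧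
      ∀ k, χ (g ^ k) = ∑ μ ∈ s, m μ * μ ^ k := by
  obtain ⟨d, ρ, hρ, rfl⟩ := hχ
  have : NeZero (Nat.card G : ℂ) := ⟨Nat.cast_ne_zero.2 Nat.card_pos.ne'⟩
  have hg : ρ g ^ Nat.card G = 1 := by rw [← map_pow, pow_card_eq_one', map_one]
  obtain ⟨s, m, hs, hm⟩ := Module.End.exists_trace_pow_eq_sum hg
  exact ⟨s, m, hs, fun k ↦ by rw [Representation.character, map_pow, hm]⟩

theorem IrrChar.isAlgebraic [Finite G] {χ : G → ℂ} (hχ : χ ∈ IrrChar G) (g : G) :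
    IsAlgebraic ℚ (χ g) := by
  obtain ⟨s, m, hs, hm⟩ := IrrChar.exists_eq_sum hχ g
  have h1 := hm 1
  rw [pow_one] at h1
  rw [h1, isAlgebraic_iff_isIntegral]
  refine IsIntegral.sum _ fun μ hμ ↦ IsIntegral.mul (isIntegral_natCast (a := m μ)) ?_
  exact (IsIntegral.of_pow Nat.card_pos (by rw [hs μ hμ]; exact isIntegral_one)).pow 1

theorem IrrChar.map_ringEquiv [Finite G] {χ : G → ℂ} (hχ : χ ∈ IrrChar G) (τ : ℂ ≃+* ℂ) (g : G) :
    τ (χ g) = χ (g ^ cyclotomicExponent (Nat.card G) τ) := by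
  obtain ⟨s, m, hs, hm⟩ := IrrChar.exists_eq_sum hχ g
  have h1 := hm 1
  rw [pow_one] at h1
  rw [h1, hm, map_sum]
  refine Finset.sum_congr rfl fun μ hμ ↦ ?_
  rw [map_mul, map_natCast, pow_one, map_eq_pow_cyclotomicExponent τ (hs μ hμ)]

noncomputable instance : MulAction (ℂ ≃+* ℂ) (IrrChar G) where
  smul τ χ := ⟨_, IrrChar.comp_mem χ.2 τ⟩
  one_smul _ := rfl
  mul_smul _ _ _ := rfl

theorem IrrChar.smul_apply (τ : ℂ ≃+* ℂ) (χ : IrrChar G) (g : G) : (τ • χ).1 g = τ (χ.1 g) := rfl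

/-- An irreducible character as a function on the conjugacy classes. -/
def IrrChar.onConjClasses (χ : IrrChar G) (K : ConjClasses G) : ℂ :=
  Quotient.lift χ.1 (fun _ _ h ↦ IrrChar.eq_of_isConj χ.2 h) K

theorem IrrChar.linearIndependent_onConjClasses [Finite G] :
    LinearIndependent ℂ (IrrChar.onConjClasses (G := G)) :=
  LinearIndependent.of_comp (LinearMap.funLeft ℂ ℂ ConjClasses.mk) IrrChar.linearIndependent

/-- By completeness, a class function is determined by its pairings with the irreducible characters.
-/
theorem IrrChar.card_conjClasses_le [Finite G] : Nat.card (ConjClasses G) ≤ Nat.card (IrrChar G) := by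
  cases nonempty_fintype G
  cases nonempty_fintype (IrrChar G)
  cases nonempty_fintype (ConjClasses G)
  let M : (ConjClasses G → ℂ) →ₗ[ℂ] (IrrChar G → ℂ) :=
    { toFun f χ := ∑ g, f (ConjClasses.mk g) * χ.1 g
      map_add' f f' := by ext; simp [add_mul, Finset.sum_add_distrib]
      map_smul' c f := by ext; simp [mul_assoc, Finset.mul_sum] }
  have hM : Function.Injective M := by
    rw [injective_iff_map_eq_zero]
    intro f hf
    have := IrrChar.eq_zero_of_forall_sum_eq_zero (f := fun g ↦ f (ConjClasses.mk g))
      (fun g h ↦ by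
        congr 1
        exact ConjClasses.mk_eq_mk_iff_isConj.2
          (isConj_iff.2 ⟨h, by rw [mul_assoc, mul_assoc, mul_inv_cancel, mul_one]⟩))
      (fun χ hχ ↦ congrFun hf ⟨χ, hχ⟩)
    funext K
    obtain ⟨g, rfl⟩ := ConjClasses.exists_rep K
    exact congrFun this g
  simpa using LinearMap.finrank_le_finrank_of_injective hM

/-- The character table as a linear equivalence. -/
noncomputable def charTableEquiv (G : Type*) [Group G] [Finite G] [Fintype (IrrChar G)] :
    (IrrChar G → ℂ) ≃ₗ[ℂ] (ConjClasses G → ℂ) :=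
  LinearEquiv.ofInjectiveOfFinrankEq (Fintype.linearCombination ℂ IrrChar.onConjClasses)
    (linearIndependent_iff_injective_fintypeLinearCombination.1 IrrChar.linearIndependent_onConjClasses) (by
      have h1 := LinearMap.finrank_le_finrank_of_injective
        (linearIndependent_iff_injective_fintypeLinearCombination.1
          (IrrChar.linearIndependent_onConjClasses (G := G)))
      have h2 := IrrChar.card_conjClasses_le (G := G)
      cases nonempty_fintype (ConjClasses G)
      simp only [Module.finrank_fintype_fun_eq_card, Nat.card_eq_fintype_card] at h1 h2 ⊢
      exact le_antisymm h1 h2)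

theorem charTableEquiv_apply [Finite G] [Fintype (IrrChar G)] (c : IrrChar G → ℂ)
    (K : ConjClasses G) : charTableEquiv G c K = ∑ χ : IrrChar G, c χ * IrrChar.onConjClasses χ K := by
  change Fintype.linearCombination ℂ IrrChar.onConjClasses c K = _
  simp [Fintype.linearCombination_apply]

/-- The indicator of `K` is a combination of characters. Separation of classes yields the action
laws below with no computation of exponents. -/
theorem ConjClasses.eq_of_forall_irrChar [Finite G] {K K' : ConjClasses G}
    (h : ∀ χ : IrrChar G, IrrChar.onConjClasses χ K = IrrChar.onConjClasses χ K') : K = K' := by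
  classical
  cases nonempty_fintype (IrrChar G)
  obtain ⟨c, hc⟩ := (charTableEquiv G).surjective (Pi.single K 1)
  have h1 : charTableEquiv G c K = charTableEquiv G c K' := by
    simp only [charTableEquiv_apply, h]
  rw [hc, Pi.single_eq_same] at h1
  by_contra hne
  rw [Pi.single_eq_of_ne' hne] at h1
  exact one_ne_zero h1

/-- The class of `g` is sent by `τ` to the class of `g ^ k`, where `τ` acts on the `|G|`-th roots
of unity as the `k`-th power map. -/
noncomputable instance [Finite G] : SMul (ℂ ≃+* ℂ) (ConjClasses G) where
  smul τ := Quotient.map (· ^ cyclotomicExponent (Nat.card G) τ) fun a b h ↦ by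
    obtain ⟨c, rfl⟩ := isConj_iff.1 h
    exact isConj_iff.2 ⟨c, by simp⟩

theorem IrrChar.onConjClasses_smul [Finite G] (χ : IrrChar G) (τ : ℂ ≃+* ℂ) (K : ConjClasses G) :
    IrrChar.onConjClasses χ (τ • K) = τ (IrrChar.onConjClasses χ K) := by
  obtain ⟨g, rfl⟩ := ConjClasses.exists_rep K
  exact (IrrChar.map_ringEquiv χ.2 τ g).symm

theorem IrrChar.smul_onConjClasses (χ : IrrChar G) (τ : ℂ ≃+* ℂ) (K : ConjClasses G) :
    IrrChar.onConjClasses (τ • χ) K = τ (IrrChar.onConjClasses χ K) := by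
  obtain ⟨g, rfl⟩ := ConjClasses.exists_rep K
  rfl

noncomputable instance [Finite G] : MulAction (ℂ ≃+* ℂ) (ConjClasses G) where
  one_smul K := ConjClasses.eq_of_forall_irrChar fun χ ↦ by
    rw [IrrChar.onConjClasses_smul]; rfl
  mul_smul σ τ K := ConjClasses.eq_of_forall_irrChar fun χ ↦ by
    simp only [IrrChar.onConjClasses_smul]; rfl

theorem charTableEquiv_mem_invariantFunctions [Finite G] [Fintype (IrrChar G)]
    (c : IrrChar G → ℂ) : c ∈ invariantFunctions ℂ (ℂ ≃+* ℂ) (IrrChar G) ↔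
      charTableEquiv G c ∈ invariantFunctions ℂ (ℂ ≃+* ℂ) (ConjClasses G) := by
  -- Moving the columns of the table by `τ` has the same effect as moving its rows by `τ`.
  have key (τ : ℂ ≃+* ℂ) (K : ConjClasses G) :
      charTableEquiv G c (τ • K) = charTableEquiv G (fun χ ↦ c (τ⁻¹ • χ)) K := by
    simp only [charTableEquiv_apply]
    refine Fintype.sum_equiv (MulAction.toPerm τ) _ _ fun χ ↦ ?_
    rw [MulAction.toPerm_apply, inv_smul_smul, IrrChar.onConjClasses_smul,
      IrrChar.smul_onConjClasses]
  constructor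
  · intro hc τ K
    rw [key]
    simp only [hc _ _]
  · intro hc τ χ
    have : (fun χ ↦ c (τ⁻¹⁻¹ • χ)) = c :=
      (charTableEquiv G).injective (funext fun K ↦ by rw [← key, hc])
    simpa using congrFun this χ

theorem charField_ne_bot_iff [Finite G] (χ : IrrChar G) :
    charField χ.1 ≠ ⊥ ↔ ∃ τ : ℂ ≃+* ℂ, τ • χ ≠ χ := by
  rw [← not_iff_not, not_not, charField, IntermediateField.adjoin_eq_bot_iff]
  push Not
  constructor
  · intro h τ
    ext g
    exact (Complex.mem_bot_iff_forall_ringEquiv (IrrChar.isAlgebraic χ.2 g)).1 (h ⟨g, rfl⟩) τ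
  · rintro h _ ⟨g, rfl⟩
    refine (Complex.mem_bot_iff_forall_ringEquiv (IrrChar.isAlgebraic χ.2 g)).2 fun τ ↦ ?_
    rw [← IrrChar.smul_apply, h]

theorem elementField_ne_bot_iff [Finite G] (x : G) :
    elementField x ≠ ⊥ ↔ ∃ τ : ℂ ≃+* ℂ, τ • ConjClasses.mk x ≠ ConjClasses.mk x := by
  rw [← not_iff_not, not_not, elementField, IntermediateField.adjoin_eq_bot_iff]
  push Not
  constructor
  · intro h τ
    refine ConjClasses.eq_of_forall_irrChar fun χ ↦ ?_
    rw [IrrChar.onConjClasses_smul]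
    exact (Complex.mem_bot_iff_forall_ringEquiv (IrrChar.isAlgebraic χ.2 x)).1
      (h ⟨χ.1, χ.2, rfl⟩) τ
  · rintro h _ ⟨χ, hχ, rfl⟩
    refine (Complex.mem_bot_iff_forall_ringEquiv (IrrChar.isAlgebraic hχ x)).2 fun τ ↦ ?_
    have := IrrChar.onConjClasses_smul ⟨χ, hχ⟩ τ (ConjClasses.mk x)
    rw [h] at this
    exact this.symm

theorem irrationalChars_eq [Finite G] :
    irrationalChars G = Subtype.val '' {χ : IrrChar G | ∃ τ : ℂ ≃+* ℂ, τ • χ ≠ χ} := by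
  ext χ
  constructor
  · rintro ⟨hχ, h⟩
    exact ⟨⟨χ, hχ⟩, (charField_ne_bot_iff ⟨χ, hχ⟩).1 h, rfl⟩
  · rintro ⟨χ, h, rfl⟩
    exact ⟨χ.2, (charField_ne_bot_iff χ).2 h⟩

theorem irrationalClasses_eq [Finite G] :
    irrationalClasses G = {K | ∃ τ : ℂ ≃+* ℂ, τ • K ≠ K} := by
  ext K
  constructor
  · rintro ⟨x, rfl, h⟩
    exact (elementField_ne_bot_iff x).1 h
  · intro h
    obtain ⟨x, rfl⟩ := ConjClasses.exists_rep K
    exact ⟨x, rfl, (elementField_ne_bot_iff x).2 h⟩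

end GaloisAction

theorem mainTheorem3 (G : Type*) [Group G] [Finite G] (n : ℕ) :
    ((irrationalClasses G).encard = n →
      (irrationalChars G).Finite ∧ ((irrationalChars G).ncard : ℝ) ≤ (n : ℝ) ^ 2 / 2) ∧
    ((irrationalChars G).encard = n →
      (irrationalClasses G).Finite ∧ ((irrationalClasses G).ncard : ℝ) ≤ (n : ℝ) ^ 2 / 2) := by
  cases nonempty_fintype (IrrChar G)
  have h1 := ncard_moved_le (charTableEquiv G) charTableEquiv_mem_invariantFunctions
  have h2 := ncard_moved_le (charTableEquiv G).symm (fun c ↦ by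
    rw [charTableEquiv_mem_invariantFunctions, LinearEquiv.apply_symm_apply])
  rw [← irrationalClasses_eq, ← Set.ncard_image_of_injective _ Subtype.val_injective,
    ← irrationalChars_eq] at h1 h2
  refine ⟨fun h ↦ ⟨?_, ?_⟩, fun h ↦ ⟨Set.toFinite _, ?_⟩⟩
  · rw [irrationalChars_eq]
    exact Set.toFinite _
  · have hn : (irrationalClasses G).ncard = n := by rw [Set.ncard, h]; rfl
    rw [hn] at h1
    have : (2 : ℝ) * (irrationalChars G).ncard ≤ (n : ℝ) ^ 2 := by exact_mod_cast h1
    linarith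
  · have hn : (irrationalChars G).ncard = n := by rw [Set.ncard, h]; rfl
    rw [hn] at h2
    have : (2 : ℝ) * (irrationalClasses G).ncard ≤ (n : ℝ) ^ 2 := by exact_mod_cast h2
    linarith
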